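/- Let $q$ be a prime, let $K,L,m\ge 1$ and $T\ge 0$ be integers with $m\le L$, and let $N$ be the number of workers. Let $A\in\mathbb F_q^{r\times s}$ be split into $K$ consecutive row blocks $A_1,\dots,A_K$ of equal size and $B\in\mathbb F_q^{s\times c}$ into $L$ consecutive column blocks $B_1,\dots,B_L$ of equal size. With mask matrices $R_i\in\mathbb F_q^{(r/K)\times s}$ and $S_{i,j}\in\mathbb F_q^{s\times (c/L)}$ put $$A(x)=\sum_{i=1}^{K}A_i x^{i-1}+\sum_{i=1}^{T}R_i x^{K+i-1},\qquad B(x,y)=\sum_{i=1}^{L}B_i y^{i-1}+\sum_{i=1}^{T}\sum_{j=1}^{m}S_{i,j}x^{K+i-1}y^{j-1}.$$ Worker $i$ has an evaluation point $(x_i,y_i)$ and returns the products $A(x_i)\,\partial_jB(x_i,y_i)$, $j=0,1,\dots,m-1$, in increasing order of $j$, where $\partial_j$ is the $j$-th partial derivative with respect to $y$. Fix the numbers $c_i\le m$ of results received from the workers, so that from worker $i$ the results with $j=0,\dots,c_i-1$ are available, and suppose that the total number of results is at least the recovery threshold: $$\sum_{i=1}^N c_i\ \ge\ R_{th}:=(K+T)L+m(K+T-1).$$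 Let the points $(x_1,y_1),\dots,(x_N,y_N)$ be chosen independently and uniformly at random from $\mathbb F_q^2$. Then, with probability at least $1-d/q$, where $$d=\frac m2\Big(3(K+T)^2+m(K+T)-6K-6T-m+3\Big)+\frac{(K+T)L}{2}\,(K+L+T-2),$$ the master can interpolate $A(x)B(x,y)$, that is: for all $A,B,R_i,S_{i,j}$, the polynomial $A(x)B(x,y)$ is the unique polynomial $P(x,y)$ with coefficients in $\mathbb F_q^{(r/K)\times(c/L)}$ such that $P$ involves only monomials $x^ay^b$ with ($0\le a\le K+T-1$, $0\le b\le L-1$) or ($0\le a\le 2(K+T)-2$, $0\le b\le m-1$), and $\partial_jP(x_i,y_i)=A(x_i)\,\partial_jB(x_i,y_i)$ for all $i$ and all $0\le j<c_i$. The number $d$ is the sum of the total degrees of these monomials. -/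

import Mathlib

namespace BivariateCode

/-- Polynomials in two variables over `𝔽_q`; the variable `0` is `x`, the variable `1` is `y`. -/
abbrev BiPoly (q : ℕ) : Type := MvPolynomial (Fin 2) (ZMod q)

/-- Constant matrix polynomial. -/
noncomputable def constMat {q a b : ℕ} (M : Matrix (Fin a) (Fin b) (ZMod q)) :
    Matrix (Fin a) (Fin b) (BiPoly q) :=
  M.map MvPolynomial.C

/-- Entrywise `j`-th partial derivative with respect to `y`. -/
noncomputable def dY {q a b : ℕ} (j : ℕ) (M : Matrix (Fin a) (Fin b) (BiPoly q)) :
    Matrix (Fin a) (Fin b) (BiPoly q) :=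
  M.map fun p => (⇑(MvPolynomial.pderiv (R := ZMod q) (1 : Fin 2)))^[j] p

/-- Entrywise evaluation at the point `z = (x, y)`. -/
noncomputable def evalAt {q a b : ℕ} (z : ZMod q × ZMod q)
    (M : Matrix (Fin a) (Fin b) (BiPoly q)) : Matrix (Fin a) (Fin b) (ZMod q) :=
  M.map fun p => MvPolynomial.eval ![z.1, z.2] p

/-- The `i`-th of the `K` consecutive row blocks (`ρ` rows each) of `A`. -/
def rowBlock {q K ρ s : ℕ} (A : Matrix (Fin (K * ρ)) (Fin s) (ZMod q)) (i : Fin K) :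
    Matrix (Fin ρ) (Fin s) (ZMod q) :=
  Matrix.of fun a b => A (finProdFinEquiv (i, a)) b

/-- The `j`-th of the `L` consecutive column blocks (`γ` columns each) of `B`. -/
def colBlock {q L s γ : ℕ} (B : Matrix (Fin s) (Fin (L * γ)) (ZMod q)) (j : Fin L) :
    Matrix (Fin s) (Fin γ) (ZMod q) :=
  Matrix.of fun a b => B a (finProdFinEquiv (j, b))

/-- `A(x) = ∑_{i<K} A_i x^i + ∑_{t<T} R_t x^{K+t}` (indices start at `0`). -/
noncomputable def encA {q K T ρ s : ℕ} (A : Matrix (Fin (K * ρ)) (Fin s) (ZMod q))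
    (R : Fin T → Matrix (Fin ρ) (Fin s) (ZMod q)) : Matrix (Fin ρ) (Fin s) (BiPoly q) :=
  (∑ i : Fin K, (MvPolynomial.X 0 ^ (i : ℕ) : BiPoly q) • constMat (rowBlock A i)) +
    ∑ t : Fin T, (MvPolynomial.X 0 ^ (K + (t : ℕ)) : BiPoly q) • constMat (R t)

/-- `B(x,y) = ∑_{l<L} B_l y^l + ∑_{t<T} ∑_{j<m} S_{t,j} x^{K+t} y^j` (indices start at `0`). -/
noncomputable def encB {q L m T s γ : ℕ} (K : ℕ) (B : Matrix (Fin s) (Fin (L * γ)) (ZMod q))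
    (S : Fin T → Fin m → Matrix (Fin s) (Fin γ) (ZMod q)) : Matrix (Fin s) (Fin γ) (BiPoly q) :=
  (∑ l : Fin L, (MvPolynomial.X 1 ^ (l : ℕ) : BiPoly q) • constMat (colBlock B l)) +
    ∑ t : Fin T, ∑ j : Fin m,
      (MvPolynomial.X 0 ^ (K + (t : ℕ)) * MvPolynomial.X 1 ^ (j : ℕ) : BiPoly q) •
        constMat (S t j)

/-- The exponents `(a, b)` of the monomials `x^a y^b` of `A(x)B(x,y)`: either `a ≤ K+T-1` and
`b ≤ L-1`, or `a ≤ 2(K+T)-2` and `b ≤ m-1`. -/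
def monomials (K L m T : ℕ) : Set (Fin 2 →₀ ℕ) :=
  {e | (e 0 < K + T ∧ e 1 < L) ∨ (e 0 + 1 < 2 * (K + T) ∧ e 1 < m)}

/-- The result of the sub-task of derivative order `j` at a worker with evaluation point `z`:
`A(x) · ∂_j B(x,y)`, both factors evaluated at `z`. -/
noncomputable def response {q K L m T ρ s γ : ℕ} (A : Matrix (Fin (K * ρ)) (Fin s) (ZMod q))
    (B : Matrix (Fin s) (Fin (L * γ)) (ZMod q))
    (R : Fin T → Matrix (Fin ρ) (Fin s) (ZMod q))
    (S : Fin T → Fin m → Matrix (Fin s) (Fin γ) (ZMod q))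
    (z : ZMod q × ZMod q) (j : ℕ) : Matrix (Fin ρ) (Fin γ) (ZMod q) :=
  evalAt z (encA A R) * evalAt z (dY j (encB K B S))

/-- Worker `i` has returned its first `c i` results (derivative orders `0, …, c i - 1`) and its
evaluation point is `z i`. The matrix polynomial `P` solves the interpolation problem posed by
these results: its entries use only the monomials of `A(x)B(x,y)`, and its `y`-derivatives at the
evaluation points are the results received. -/
def IsInterpolant {q K L m T ρ s γ N : ℕ} (A : Matrix (Fin (K * ρ)) (Fin s) (ZMod q))
    (B : Matrix (Fin s) (Fin (L * γ)) (ZMod q))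
    (R : Fin T → Matrix (Fin ρ) (Fin s) (ZMod q))
    (S : Fin T → Fin m → Matrix (Fin s) (Fin γ) (ZMod q))
    (c : Fin N → ℕ) (z : Fin N → ZMod q × ZMod q)
    (P : Matrix (Fin ρ) (Fin γ) (BiPoly q)) : Prop :=
  (∀ a b, ∀ e ∈ (P a b).support, e ∈ monomials K L m T) ∧
    ∀ i : Fin N, ∀ j < c i, evalAt (z i) (dY j P) = response A B R S (z i) j

/-- The master can interpolate: whatever the matrices `A`, `B` and the masks `R`, `S` are, the
interpolation problem posed by the results received has the unique solution `A(x)B(x,y)`. -/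
def CanInterpolate {q N : ℕ} (K L m T ρ s γ : ℕ) (c : Fin N → ℕ)
    (z : Fin N → ZMod q × ZMod q) : Prop :=
  ∀ (A : Matrix (Fin (K * ρ)) (Fin s) (ZMod q)) (B : Matrix (Fin s) (Fin (L * γ)) (ZMod q))
    (R : Fin T → Matrix (Fin ρ) (Fin s) (ZMod q))
    (S : Fin T → Fin m → Matrix (Fin s) (Fin γ) (ZMod q))
    (P : Matrix (Fin ρ) (Fin γ) (BiPoly q)),
    IsInterpolant A B R S c z P ↔ P = encA A R * encB K B S

/-- The recovery threshold. -/
def recoveryThreshold (K L m T : ℕ) : ℕ := (K + T) * L + m * (K + T - 1)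

/-- The sum of the total degrees of the monomials of `A(x)B(x,y)`, in closed form. -/
noncomputable def degreeSum (K L m T : ℕ) : ℝ :=
  (m : ℝ) / 2 * (3 * ((K : ℝ) + T) ^ 2 + m * ((K : ℝ) + T) - 6 * K - 6 * T - m + 3) +
    ((K : ℝ) + T) * L / 2 * ((K : ℝ) + L + T - 2)

end BivariateCode

/-! The product `A(x)B(x,y)` lies in the span of `R_th` monomials, so `R_th` of the received results
give a square linear system for its coefficients. Its determinant is a polynomial in the coordinates
of the points, of total degree at most `d`: in each Leibniz term every monomial contributes at most
its own degree. If this polynomial is nonzero, Schwartz-Zippel (`card_zeros_le`) bounds the singular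
choices of points by a fraction `d/q`, and any other choice permits interpolation
(`canInterpolate_of_det_ne_zero`).

Nonvanishing may be tested over the algebraic closure, on points `(t ^ L, t)`. There `x^a y^b`
becomes `t ^ (L * a + b)`, and these exponents increase strictly when the monomials are listed
column by column. Workers are added one at a time, each with the next block of monomials
(`exists_params_kernel_trivial`). As the new parameter tends formally to infinity, the dominant part
of the determinant is the old determinant times one of falling factorials of the new `y`-exponents.
The latter is a Vandermonde determinant. It is nonzero because any `m` consecutive monomials have
distinct `y`-exponents (`expY_ne`), which stay distinct mod `q` since `L ≤ q`. If `d ≥ q` the bound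
is trivial; otherwise `L - 1 ≤ d < q`. -/

namespace BivariateCode

/-! ### Hermite-type interpolation on a monomial curve -/

open Matrix in
/-- If the exponents of the new columns exceed those of the old ones, then adjoining to an
invertible matrix `A` a block of rows with entries in powers of one parameter `t` keeps it
invertible for a suitable `t`, provided the coefficient matrix `D` of the new square block is
invertible. -/
lemma exists_det_fromBlocks_ne_zero {k ι κ : Type*} [Field k] [Infinite k] [Fintype ι]
    [DecidableEq ι] [Fintype κ] [DecidableEq κ] {A : Matrix ι ι k} (B : Matrix ι κ k)
    (C : Matrix κ ι k) {D : Matrix κ κ k} (hA : A.det ≠ 0) (hD : D.det ≠ 0)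
    {u : ι → ℕ} {w : κ → ℕ} {w₀ : ℕ} (hu : ∀ i, u i < w₀) (hw : ∀ j, w₀ ≤ w j) :
    ∃ t : k, t ≠ 0 ∧ (fromBlocks A B (of fun j e => C j e * t ^ u e)
      (of fun j e => D j e * t ^ w e)).det ≠ 0 := by
  classical
  -- Put `t = v⁻¹`, scale the new rows by `v ^ w₀` and the new columns by `v ^ (w e - w₀)`. All
  -- entries become polynomial in `v`, and at `v = 0` the matrix is block triangular with diagonal
  -- blocks `A` and `D`.
  let Q : Matrix (ι ⊕ κ) (ι ⊕ κ) (Polynomial k) :=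
    fromBlocks (of fun i e => Polynomial.C (A i e))
      (of fun i e => Polynomial.C (B i e) * Polynomial.X ^ (w e - w₀))
      (of fun j e => Polynomial.C (C j e) * Polynomial.X ^ (w₀ - u e))
      (of fun j e => Polynomial.C (D j e))
  have hQ (v : k) : Polynomial.eval v Q.det =
      (fromBlocks A (of fun i e => B i e * v ^ (w e - w₀))
        (of fun j e => C j e * v ^ (w₀ - u e)) D).det := by
    rw [← Polynomial.coe_evalRingHom, RingHom.map_det]
    congr 1
    ext (i | i) (j | j) <;> simp [Q]
  have h0 : Polynomial.eval 0 Q.det ≠ 0 := by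
    have hC : (of fun j e => C j e * (0 : k) ^ (w₀ - u e)) = 0 := by
      ext j e
      simp [(Nat.sub_pos_of_lt (hu e)).ne']
    rw [hQ, hC, det_fromBlocks_zero₂₁]
    exact mul_ne_zero hA hD
  -- The factor `X` makes the non-root `v` nonzero, hence invertible.
  have hne : Q.det * Polynomial.X ≠ 0 :=
    mul_ne_zero (fun h => h0 (by simp [h])) Polynomial.X_ne_zero
  obtain ⟨v, hv⟩ : ∃ v, Polynomial.eval v (Q.det * Polynomial.X) ≠ 0 := by
    by_contra! h
    exact hne (Polynomial.funext fun v => by simpa using h v)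
  rw [Polynomial.eval_mul, Polynomial.eval_X] at hv
  have hv0 : v ≠ 0 := right_ne_zero_of_mul hv
  refine ⟨v⁻¹, inv_ne_zero hv0, fun hdet => left_ne_zero_of_mul hv ?_⟩
  have hfac : fromBlocks A (of fun i e => B i e * v ^ (w e - w₀))
        (of fun j e => C j e * v ^ (w₀ - u e)) D =
      diagonal (Sum.elim (fun _ => 1) fun _ => v ^ w₀) *
        fromBlocks A B (of fun j e => C j e * v⁻¹ ^ u e) (of fun j e => D j e * v⁻¹ ^ w e) *
        diagonal (Sum.elim (fun _ => 1) fun e => v ^ (w e - w₀)) := by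
    ext (i | i) (j | j)
    · simp
    · simp
    · have : v ^ (w₀ - u j) = v ^ w₀ * v⁻¹ ^ u j := by
        rw [inv_pow, pow_sub₀ _ hv0 (hu j).le]
      simp [this]
      ring
    · have : v ^ w₀ * v ^ (w j - w₀) * (v ^ w j)⁻¹ = 1 := by
        rw [← pow_add, Nat.add_sub_cancel' (hw j), mul_inv_cancel₀ (pow_ne_zero _ hv0)]
      simp only [fromBlocks_apply₂₂, mul_diagonal, diagonal_mul, Sum.elim_inr, of_apply, inv_pow]
      linear_combination -(D i j) * this
  rw [hQ, hfac, det_mul, det_mul, hdet]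
  ring

-- Falling factorials are monic polynomials of degrees `0, 1, …`, so row operations turn this into a
-- Vandermonde matrix.
open Matrix in
lemma det_descFactorial_ne_zero {k : Type*} [Field k] {n : ℕ} (b : Fin n → ℕ)
    (hb : Function.Injective fun i => (b i : k)) :
    (of fun j i : Fin n => ((b i).descFactorial j : k)).det ≠ 0 := by
  rw [← det_transpose]
  have h := det_eval_matrixOfPolynomials_eq_det_vandermonde (fun i => (b i : k))
    (fun j => descPochhammer k j) (fun j => descPochhammer_natDegree k j)
    (fun j => monic_descPochhammer k j)
  have h' := det_vandermonde_ne_zero_iff.2 hb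
  rw [h] at h'
  convert h' using 2
  ext i j
  simp [descPochhammer_eval_eq_descFactorial]

open Matrix in
/-- Hermite-type interpolation along the curve `(t ^ W, t)`: for suitable parameters `t l`, the
conditions of order `< c l` at `t l` determine the coefficients of the first `∑ c l` monomials. -/
lemma exists_params_kernel_trivial {k : Type*} [Field k] [Infinite k] {m : ℕ} {w b : ℕ → ℕ}
    (hw : StrictMono w)
    (hb : ∀ e e', e < e' → e' < e + m → (b e : k) ≠ b e') (c : ℕ → ℕ) (hc : ∀ l, c l ≤ m) (i : ℕ) :
    ∃ t : ℕ → k, (∀ l, t l ≠ 0) ∧ ∀ f : ℕ → k,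
      (∀ l < i, ∀ j < c l, ∑ e ∈ Finset.range (∑ l ∈ Finset.range i, c l),
        (b e).descFactorial j * t l ^ w e * f e = 0) →
      ∀ e < ∑ l ∈ Finset.range i, c l, f e = 0 := by
  induction i with
  | zero => exact ⟨fun _ => 1, by simp, by simp⟩
  | succ i ih =>
    obtain ⟨t, ht0, ht⟩ := ih
    rw [Finset.sum_range_succ]
    set n := ∑ l ∈ Finset.range i, c l with hn
    have σ : Fin n ≃ (l : Fin i) × Fin (c l) := Fintype.equivOfCardEq (by
      simp [hn, Fin.sum_univ_eq_sum_range c])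
    let A : Matrix (Fin n) (Fin n) k :=
      of fun r e => (b e).descFactorial (σ r).2 * t (σ r).1 ^ w e
    let B : Matrix (Fin n) (Fin (c i)) k :=
      of fun r e => (b (n + e)).descFactorial (σ r).2 * t (σ r).1 ^ w (n + e)
    let C : Matrix (Fin (c i)) (Fin n) k := of fun j e => ((b e).descFactorial j : k)
    let D : Matrix (Fin (c i)) (Fin (c i)) k := of fun j e => ((b (n + e)).descFactorial j : k)
    have hA : A.det ≠ 0 := by
      intro hdet
      obtain ⟨v, hv, hv0⟩ := exists_mulVec_eq_zero_iff.2 hdet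
      refine hv (funext fun e => ?_)
      -- A kernel vector of `A`, extended by zero, meets the induction hypothesis.
      have := ht (fun e => if h : e < n then v ⟨e, h⟩ else 0) (fun l hl j hj => ?_) e e.2
      · simpa using this
      · have h := congrFun hv0 (σ.symm ⟨⟨l, hl⟩, ⟨j, hj⟩⟩)
        simp only [mulVec, dotProduct, A, of_apply, Pi.zero_apply] at h
        rw [σ.apply_symm_apply] at h
        rw [Finset.sum_range]
        simpa using h
    have hD : D.det ≠ 0 := by
      refine det_descFactorial_ne_zero (fun e : Fin (c i) => b (n + e)) fun e e' h => ?_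
      have := hc i
      rcases lt_trichotomy (e : ℕ) e' with hlt | heq | hlt
      · exact absurd h (hb _ _ (by omega) (by omega))
      · exact Fin.ext heq
      · exact absurd h.symm (hb _ _ (by omega) (by omega))
    obtain ⟨τ, hτ0, hτ⟩ := exists_det_fromBlocks_ne_zero B C hA hD
      (u := fun e => w e) (w := fun e => w (n + e)) (w₀ := w n) (fun e => hw e.2)
      (fun e => hw.monotone (by omega))
    refine ⟨Function.update t i τ, fun l => ?_, fun f hf => ?_⟩
    · by_cases h : l = i
      · simpa [h] using hτ0
      · simpa [h] using ht0 l
    have hsplit (g : ℕ → k) : ∑ e ∈ Finset.range (n + c i), g e =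
        ∑ e : Fin n, g e + ∑ e : Fin (c i), g (n + e) := by
      rw [Finset.sum_range_add, Finset.sum_range, Finset.sum_range (fun e => g (n + e))]
    have hker : fromBlocks A B (of fun j e => C j e * τ ^ w e)
        (of fun j e => D j e * τ ^ w (n + e)) *ᵥ
          Sum.elim (fun e : Fin n => f e) (fun e : Fin (c i) => f (n + e)) = 0 := by
      ext (r | j)
      · have h := hf (σ r).1 (by omega) (σ r).2 (σ r).2.2
        rw [hsplit, Function.update_of_ne (by omega)] at h
        simpa [mulVec, dotProduct, A, B] using h
      · have h := hf i (by omega) j j.2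
        rw [hsplit, Function.update_self] at h
        simpa [mulVec, dotProduct, C, D] using h
    have hzero := eq_zero_of_mulVec_eq_zero hτ hker
    intro e he
    by_cases h : e < n
    · simpa using congrFun hzero (Sum.inl ⟨e, h⟩)
    · have := congrFun hzero (Sum.inr ⟨e - n, by omega⟩)
      simpa [Nat.add_sub_cancel' (not_lt.1 h)] using this

/-! ### Enumeration of the monomials -/

/-- `x`-exponent of the `e`-th monomial, in the order that runs through the columns `x ^ a`. -/
def expX (n L m e : ℕ) : ℕ := if e < n * L then e / L else n + (e - n * L) / m

/-- `y`-exponent of the `e`-th monomial, in the order that runs through the columns `x ^ a`. -/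
def expY (n L m e : ℕ) : ℕ := if e < n * L then e % L else (e - n * L) % m

lemma expX_of_lt {n L m e : ℕ} (h : e < n * L) : expX n L m e = e / L := if_pos h

lemma expY_of_lt {n L m e : ℕ} (h : e < n * L) : expY n L m e = e % L := if_pos h

lemma expX_add (n L m e : ℕ) : expX n L m (n * L + e) = n + e / m := by simp [expX]

lemma expY_add (n L m e : ℕ) : expY n L m (n * L + e) = e % m := by simp [expY]

lemma expY_lt {n L m : ℕ} (hm : 0 < m) (hmL : m ≤ L) (e : ℕ) : expY n L m e < L := by
  unfold expY
  split_ifs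
  · exact Nat.mod_lt _ (by omega)
  · exact (Nat.mod_lt _ hm).trans_le hmL

/-- Within a column the `y`-exponent grows by one; passing to the next column gains `L`, more than
the `y`-exponent can lose. -/
lemma strictMono_weight {n L m : ℕ} (hm : 0 < m) (hmL : m ≤ L) :
    StrictMono fun e => L * expX n L m e + expY n L m e := by
  refine strictMono_nat_of_lt_succ fun e => ?_
  rcases lt_or_ge e (n * L) with h | h
  · rw [expX_of_lt h, expY_of_lt h, Nat.div_add_mod]
    rcases lt_or_ge (e + 1) (n * L) with h' | h'
    · rw [expX_of_lt h', expY_of_lt h', Nat.div_add_mod]; omega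
    · obtain ⟨e', he'⟩ := Nat.exists_eq_add_of_le h'
      rw [he', expX_add]
      nlinarith [Nat.zero_le (L * (e' / m))]
  · obtain ⟨e', rfl⟩ := Nat.exists_eq_add_of_le h
    rw [add_assoc, expX_add, expY_add, expX_add, expY_add]
    have h1 := Nat.div_add_mod e' m
    have h2 := Nat.mod_lt e' hm
    rcases Nat.lt_or_ge (e' % m + 1) m with h3 | h3
    · have hd : (e' + 1) / m = e' / m := by
        rw [Nat.div_eq_iff hm, mul_comm]; omega
      have hr : (e' + 1) % m = e' % m + 1 := by
        have := Nat.div_add_mod (e' + 1) m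
        rw [hd] at this; omega
      rw [hd, hr]; omega
    · have hd : (e' + 1) / m = e' / m + 1 := by
        rw [Nat.div_eq_iff hm, add_mul, one_mul, mul_comm]; omega
      rw [hd]
      nlinarith [Nat.zero_le ((e' + 1) % m)]

lemma mod_ne_mod_of_lt {e e' m : ℕ} (h : e < e') (h' : e' < e + m) : e % m ≠ e' % m := by
  intro heq
  have := Nat.le_of_dvd (by omega) ((Nat.modEq_iff_dvd' h.le).1 heq)
  omega

/-- The `y`-exponents run cyclically with period `L`, then `m`. A window of length `m` across the
change pairs the top of a long column with the bottom of a short one. -/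
lemma expY_ne {n L m : ℕ} (hmL : m ≤ L) {e e' : ℕ} (h : e < e')
    (h' : e' < e + m) : expY n L m e ≠ expY n L m e' := by
  rcases lt_or_ge e (n * L) with h1 | h1
  · rcases lt_or_ge e' (n * L) with h2 | h2
    · rw [expY_of_lt h1, expY_of_lt h2]
      exact mod_ne_mod_of_lt h (by omega)
    · obtain ⟨v, rfl⟩ := Nat.exists_eq_add_of_le h2
      rw [expY_of_lt h1, expY_add, Nat.mod_eq_of_lt (a := v) (by omega)]
      obtain ⟨n, rfl⟩ : ∃ n', n = n' + 1 := ⟨n - 1, by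
        rcases n with _ | n
        · simp at h1
        · rfl⟩
      rw [add_mul, one_mul] at *
      obtain ⟨u, rfl⟩ := Nat.exists_eq_add_of_le (show n * L ≤ e by omega)
      rw [mul_comm, Nat.mul_add_mod, Nat.mod_eq_of_lt (by omega)]
      omega
  · obtain ⟨u, rfl⟩ := Nat.exists_eq_add_of_le h1
    obtain ⟨v, rfl⟩ := Nat.exists_eq_add_of_le (h1.trans h.le)
    rw [expY_add, expY_add]
    exact mod_ne_mod_of_lt (by omega) (by omega)

lemma sum_range_mul_div_mod {M : Type*} [AddCommMonoid M] (g : ℕ → ℕ → M) (u : ℕ) {v : ℕ}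
    (hv : 0 < v) :
    ∑ e ∈ Finset.range (u * v), g (e / v) (e % v) =
      ∑ a ∈ Finset.range u, ∑ b ∈ Finset.range v, g a b := by
  induction u with
  | zero => simp
  | succ u ih =>
    rw [add_mul, one_mul, Finset.sum_range_add, ih, Finset.sum_range_succ]
    congr 1
    refine Finset.sum_congr rfl fun b hb => ?_
    rw [Finset.mem_range] at hb
    rw [mul_comm u v, Nat.mul_add_div hv, Nat.mul_add_mod, Nat.mod_eq_of_lt hb,
      Nat.div_eq_of_lt hb, add_zero]

lemma sum_range_id_real (n : ℕ) : ∑ a ∈ Finset.range n, (a : ℝ) = n * (n - 1) / 2 := by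
  induction n with
  | zero => simp
  | succ n ih => rw [Finset.sum_range_succ, ih]; push_cast; ring

lemma sum_exponents {K L m T : ℕ} (hK : 0 < K) (hL : 0 < L) (hm : 0 < m) :
    ((∑ e ∈ Finset.range (recoveryThreshold K L m T),
      (expX (K + T) L m e + expY (K + T) L m e) : ℕ) : ℝ) = degreeSum K L m T := by
  obtain ⟨n, hn⟩ : ∃ n, K + T = n + 1 := ⟨K + T - 1, by omega⟩
  have hn' : (K : ℝ) + T = n + 1 := by exact_mod_cast hn
  rw [recoveryThreshold, degreeSum, Finset.sum_range_add]
  have h1 : ∑ e ∈ Finset.range ((K + T) * L), (expX (K + T) L m e + expY (K + T) L m e) =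
      ∑ a ∈ Finset.range (K + T), ∑ b ∈ Finset.range L, (a + b) := by
    rw [← sum_range_mul_div_mod (fun a b => a + b) (K + T) hL]
    refine Finset.sum_congr rfl fun e he => ?_
    rw [Finset.mem_range] at he
    rw [expX_of_lt he, expY_of_lt he]
  have h2 : ∑ e ∈ Finset.range (m * (K + T - 1)), (expX (K + T) L m ((K + T) * L + e) +
      expY (K + T) L m ((K + T) * L + e)) =
      ∑ a ∈ Finset.range (K + T - 1), ∑ b ∈ Finset.range m, (K + T + a + b) := by
    rw [← sum_range_mul_div_mod (fun a b => K + T + a + b) (K + T - 1) hm, mul_comm]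
    exact Finset.sum_congr rfl fun e _ => by rw [expX_add, expY_add]
  rw [h1, h2, hn]
  push_cast
  simp only [Finset.sum_add_distrib, Finset.sum_const, Finset.card_range, nsmul_eq_mul,
    ← Finset.mul_sum, sum_range_id_real]
  have h3 : (K : ℝ) = n + 1 - T := by linarith
  rw [h3]
  push_cast
  ring

/-! ### Coordinates and derivatives in the monomial basis -/

/-- Exponent vector of the `e`-th monomial of `A(x)B(x,y)`. -/
noncomputable def monomialExp (n L m e : ℕ) : Fin 2 →₀ ℕ :=
  Finsupp.single 0 (expX n L m e) + Finsupp.single 1 (expY n L m e)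

@[simp] lemma monomialExp_zero (n L m e : ℕ) : monomialExp n L m e 0 = expX n L m e := by
  simp [monomialExp]

@[simp] lemma monomialExp_one (n L m e : ℕ) : monomialExp n L m e 1 = expY n L m e := by
  simp [monomialExp]

lemma monomialExp_injective {n L m : ℕ} (hm : 0 < m) (hmL : m ≤ L) :
    Function.Injective (monomialExp n L m) := fun e e' h =>
  (strictMono_weight (n := n) hm hmL).injective (by
    have h0 := DFunLike.congr_fun h 0
    have h1 := DFunLike.congr_fun h 1
    simp only [monomialExp_zero, monomialExp_one] at h0 h1
    simp only [h0, h1])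

lemma exists_monomialExp_eq {K L m T : ℕ} {s : Fin 2 →₀ ℕ} (hmL : m ≤ L)
    (hs : s ∈ monomials K L m T) :
    ∃ e < recoveryThreshold K L m T, monomialExp (K + T) L m e = s := by
  have key (e : ℕ) (he : e < recoveryThreshold K L m T) (h0 : expX (K + T) L m e = s 0)
      (h1 : expY (K + T) L m e = s 1) :
      ∃ e < recoveryThreshold K L m T, monomialExp (K + T) L m e = s := by
    refine ⟨e, he, ?_⟩
    ext i
    fin_cases i
    · simpa using h0
    · simpa using h1
  have hcol : s 0 < K + T → s 1 < L →
      ∃ e < recoveryThreshold K L m T, monomialExp (K + T) L m e = s := by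
    intro h0 h1
    have hlt : L * s 0 + s 1 < (K + T) * L := by nlinarith
    refine key (L * s 0 + s 1) (hlt.trans_le (Nat.le_add_right _ _)) ?_ ?_
    · rw [expX_of_lt hlt, Nat.mul_add_div (by omega), Nat.div_eq_of_lt h1, add_zero]
    · rw [expY_of_lt hlt, Nat.mul_add_mod, Nat.mod_eq_of_lt h1]
  rcases hs with ⟨h0, h1⟩ | ⟨h0, h1⟩
  · exact hcol h0 h1
  · rcases lt_or_ge (s 0) (K + T) with h | h
    · exact hcol h (h1.trans_le hmL)
    · obtain ⟨a, ha⟩ := Nat.exists_eq_add_of_le h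
      have ha' : a + 1 ≤ K + T - 1 := by omega
      refine key ((K + T) * L + (m * a + s 1)) ?_ ?_ ?_
      · rw [recoveryThreshold]
        nlinarith
      · rw [expX_add, Nat.mul_add_div (by omega), Nat.div_eq_of_lt h1, add_zero, ha]
      · rw [expY_add, Nat.mul_add_mod, Nat.mod_eq_of_lt h1]

/-- A polynomial in the monomials of `A(x)B(x,y)` is the sum of its terms in these. -/
lemma sum_monomialExp {F : Type*} [CommSemiring F] {K L m T : ℕ} (hm : 0 < m) (hmL : m ≤ L)
    {f : MvPolynomial (Fin 2) F} (hf : ∀ s ∈ f.support, s ∈ monomials K L m T) :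
    f = ∑ e ∈ Finset.range (recoveryThreshold K L m T),
      MvPolynomial.monomial (monomialExp (K + T) L m e)
        (f.coeff (monomialExp (K + T) L m e)) := by
  classical
  conv_lhs => rw [← MvPolynomial.support_sum_monomial_coeff f]
  rw [← Finset.sum_image (f := fun s => MvPolynomial.monomial s (f.coeff s))
    (fun _ _ _ _ h => monomialExp_injective hm hmL h)]
  refine Finset.sum_subset (fun s hs => ?_) fun s _ hs => ?_
  · obtain ⟨e, he, rfl⟩ := exists_monomialExp_eq hmL (hf s hs)
    exact Finset.mem_image_of_mem _ (Finset.mem_range.2 he)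
  · rw [MvPolynomial.notMem_support_iff.1 hs, MvPolynomial.monomial_zero]

lemma iterate_pderiv_monomial {F σ : Type*} [CommSemiring F] (i : σ) (j : ℕ) (s : σ →₀ ℕ) (a : F) :
    (⇑(MvPolynomial.pderiv (R := F) i))^[j] (MvPolynomial.monomial s a) =
      MvPolynomial.monomial (s - Finsupp.single i j) (a * (s i).descFactorial j) := by
  induction j with
  | zero => simp
  | succ j ih =>
    rw [Function.iterate_succ_apply', ih, MvPolynomial.pderiv_monomial, tsub_tsub,
      ← Finsupp.single_add, mul_assoc, Nat.descFactorial_succ]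
    simp [mul_comm]

lemma iterate_pderiv_sum {F σ ι : Type*} [CommSemiring F] (i : σ) (j : ℕ) (s : Finset ι)
    (f : ι → MvPolynomial σ F) :
    (⇑(MvPolynomial.pderiv (R := F) i))^[j] (∑ e ∈ s, f e) =
      ∑ e ∈ s, (⇑(MvPolynomial.pderiv (R := F) i))^[j] (f e) := by
  induction j with
  | zero => rfl
  | succ j ih => simp only [Function.iterate_succ_apply', ih, map_sum]

lemma eval_iterate_pderiv {F : Type*} [CommSemiring F] {K L m T : ℕ} (hm : 0 < m) (hmL : m ≤ L)
    {f : MvPolynomial (Fin 2) F} (hf : ∀ s ∈ f.support, s ∈ monomials K L m T) (x y : F) (j : ℕ) :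
    MvPolynomial.eval ![x, y] ((⇑(MvPolynomial.pderiv (R := F) 1))^[j] f) =
      ∑ e ∈ Finset.range (recoveryThreshold K L m T),
        (expY (K + T) L m e).descFactorial j * x ^ expX (K + T) L m e *
          y ^ (expY (K + T) L m e - j) * f.coeff (monomialExp (K + T) L m e) := by
  conv_lhs => rw [sum_monomialExp hm hmL hf, iterate_pderiv_sum, map_sum]
  refine Finset.sum_congr rfl fun e _ => ?_
  rw [iterate_pderiv_monomial, MvPolynomial.eval_monomial, Finsupp.prod_fintype _ _ (by simp)]
  simp
  ring

/-! ### The interpolation determinant -/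

/-- The matrix of the interpolation problem: row `r` is the condition of derivative order
`(σ r).2` at the point `z (σ r).1`, column `e` belongs to the `e`-th monomial. -/
def interpMatrix {k : Type*} [CommRing k] (n L m : ℕ) {R N : ℕ} {c : Fin N → ℕ}
    (σ : Fin R ≃ (i : Fin N) × Fin (c i)) (z : Fin N → k × k) : Matrix (Fin R) (Fin R) k :=
  Matrix.of fun r e => ((expY n L m e).descFactorial (σ r).2 : k) *
    (z (σ r).1).1 ^ expX n L m e * (z (σ r).1).2 ^ (expY n L m e - (σ r).2)

lemma map_det_interpMatrix {k k' : Type*} [CommRing k] [CommRing k'] (φ : k →+* k') (n L m : ℕ)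
    {R N : ℕ} {c : Fin N → ℕ} (σ : Fin R ≃ (i : Fin N) × Fin (c i)) (z : Fin N → k × k) :
    φ (interpMatrix n L m σ z).det =
      (interpMatrix n L m σ fun i => (φ (z i).1, φ (z i).2)).det := by
  rw [RingHom.map_det]
  congr 1
  ext r e
  simp [interpMatrix]

/-- Over an infinite field in which the `y`-exponents stay distinct, the interpolation problem is
regular for some choice of the points. -/
lemma exists_det_interpMatrix_ne_zero {k : Type*} [Field k] [Infinite k] {n L m R N : ℕ}
    (hm : 0 < m) (hmL : m ≤ L) (hinj : ∀ a < L, ∀ b < L, (a : k) = b → a = b)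
    {c : Fin N → ℕ} (hc : ∀ i, c i ≤ m) (σ : Fin R ≃ (i : Fin N) × Fin (c i)) :
    ∃ z : Fin N → k × k, (interpMatrix n L m σ z).det ≠ 0 := by
  let c' : ℕ → ℕ := fun l => if h : l < N then c ⟨l, h⟩ else 0
  have hsum : ∑ l ∈ Finset.range N, c' l = R := by
    have := Fintype.card_congr σ
    rw [Fintype.card_sigma] at this
    simp only [Fintype.card_fin] at this
    rw [this, Finset.sum_range]
    exact Finset.sum_congr rfl fun i _ => by simp [c']
  obtain ⟨t, ht0, ht⟩ := exists_params_kernel_trivial (k := k)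
    (w := fun e => L * expX n L m e + expY n L m e) (b := expY n L m)
    (strictMono_weight hm hmL)
    (fun e e' h h' heq => expY_ne hmL h h' (hinj _ (expY_lt hm hmL e) _ (expY_lt hm hmL e') heq))
    c' (fun l => by by_cases h : l < N <;> simp [c', h, hc]) N
  rw [hsum] at ht
  refine ⟨fun i => (t i ^ L, t i), fun hdet => ?_⟩
  obtain ⟨v, hv, hv0⟩ := Matrix.exists_mulVec_eq_zero_iff.2 hdet
  refine hv (funext fun e => ?_)
  have := ht (fun e => if h : e < R then v ⟨e, h⟩ else 0) (fun l hl j hj => ?_) e e.2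
  · simpa using this
  · have hj' : j < c ⟨l, hl⟩ := by simpa [c', hl] using hj
    have h := congrFun hv0 (σ.symm ⟨⟨l, hl⟩, ⟨j, hj'⟩⟩)
    simp only [Matrix.mulVec, dotProduct, interpMatrix, Matrix.of_apply, Pi.zero_apply] at h
    rw [σ.apply_symm_apply] at h
    -- Multiplying the row by `t ^ j` restores the power lost by differentiation; where `j` exceeds
    -- the `y`-exponent, the falling factorial vanishes.
    have h' := congrArg (fun a => t l ^ j * a) h
    simp only [Finset.mul_sum, mul_zero] at h'
    rw [Finset.sum_range, ← h']
    refine Finset.sum_congr rfl fun e _ => ?_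
    simp only [Fin.is_lt, dite_true]
    rcases lt_or_ge (expY n L m e) j with hlt | hge
    · simp [Nat.descFactorial_of_lt hlt]
    · have : t l ^ j * t l ^ (expY n L m e - j) = t l ^ expY n L m e := by
        rw [← pow_add, Nat.add_sub_cancel' hge]
      rw [pow_add, ← this, pow_mul]
      ring

open MvPolynomial in
lemma totalDegree_det_interpMatrix_le {F τ : Type*} [CommRing F] [Nontrivial F] (n L m : ℕ)
    {R N : ℕ} {c : Fin N → ℕ} (σ : Fin R ≃ (i : Fin N) × Fin (c i)) (ξ η : Fin N → τ) :
    (interpMatrix n L m σ fun i => ((X (ξ i) : MvPolynomial τ F), X (η i))).det.totalDegree ≤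
      ∑ e ∈ Finset.range R, (expX n L m e + expY n L m e) := by
  rw [Matrix.det_apply, Finset.sum_range]
  refine totalDegree_finsetSum_le fun π _ => ?_
  refine (totalDegree_smul_le _ _).trans ((totalDegree_finsetProd _ _).trans ?_)
  refine Finset.sum_le_sum fun e _ => ?_
  simp only [interpMatrix, Matrix.of_apply]
  refine (totalDegree_mul _ _).trans (add_le_add ((totalDegree_mul _ _).trans ?_) ?_)
  · rw [← C_eq_coe_nat, totalDegree_C, zero_add, totalDegree_X_pow]
  · rw [totalDegree_X_pow]
    exact Nat.sub_le _ _

/-- Discards surplus results to make the system square; each worker keeps an initial run of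
derivative orders. -/
lemma exists_le_sum_eq {ι : Type*} [Fintype ι] (c : ι → ℕ) {R : ℕ} (hR : R ≤ ∑ i, c i) :
    ∃ c' : ι → ℕ, (∀ i, c' i ≤ c i) ∧ ∑ i, c' i = R := by
  classical
  induction R with
  | zero => exact ⟨0, by simp, by simp⟩
  | succ R ih =>
    obtain ⟨c', hc', hsum⟩ := ih (by omega)
    obtain ⟨i, -, hi⟩ := Finset.exists_lt_of_sum_lt (s := Finset.univ) (f := c') (g := c) (by omega)
    refine ⟨c' + Pi.single i 1, fun l => ?_, ?_⟩
    · by_cases h : l = i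
      · subst h; simpa using hi
      · simpa [h] using hc' l
    · simp [Finset.sum_add_distrib, hsum]

/-! ### Zero counting -/

/-- The coordinates of `N` points of the plane in a single vector. -/
def coords {F : Type*} {N : ℕ} (z : Fin N → F × F) (v : Fin (N * 2)) : F :=
  ![(z (finProdFinEquiv.symm v).1).1, (z (finProdFinEquiv.symm v).1).2] (finProdFinEquiv.symm v).2

@[simp] lemma coords_fst {F : Type*} {N : ℕ} (z : Fin N → F × F) (i : Fin N) :
    coords z (finProdFinEquiv (i, 0)) = (z i).1 := by
  simp only [coords, Equiv.symm_apply_apply, Matrix.cons_val_zero]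

@[simp] lemma coords_snd {F : Type*} {N : ℕ} (z : Fin N → F × F) (i : Fin N) :
    coords z (finProdFinEquiv (i, 1)) = (z i).2 := by
  simp only [coords, Equiv.symm_apply_apply, Matrix.cons_val_one, Matrix.cons_val_fin_one]

lemma coords_injective {F : Type*} {N : ℕ} :
    Function.Injective (coords : (Fin N → F × F) → Fin (N * 2) → F) := fun z z' h =>
  funext fun i => Prod.ext
    (by simpa using congrFun h (finProdFinEquiv (i, 0)))
    (by simpa using congrFun h (finProdFinEquiv (i, 1)))

/-- Zero counting for a polynomial in the coordinates of `N` points of the plane. -/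
lemma card_zeros_le {F : Type*} [Field F] [Fintype F] [DecidableEq F] {N : ℕ}
    {p : MvPolynomial (Fin (N * 2)) F} (hp : p ≠ 0) :
    ((Finset.univ.filter fun z : Fin N → F × F =>
        MvPolynomial.eval (coords z) p = 0).card : ℝ) / Fintype.card (Fin N → F × F) ≤
      p.totalDegree / Fintype.card F := by
  have h := MvPolynomial.schwartz_zippel_totalDegree hp (Finset.univ : Finset F)
  have h' : (((Fintype.piFinset fun _ : Fin (N * 2) => (Finset.univ : Finset F)).filter
      fun f => MvPolynomial.eval f p = 0).card : ℝ) / (Fintype.card F : ℝ) ^ (N * 2) ≤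
      p.totalDegree / Fintype.card F := by
    rw [Finset.card_univ] at h
    simpa only [NNRat.cast_div, NNRat.cast_pow, NNRat.cast_natCast] using
      (NNRat.cast_le (K := ℝ)).2 h
  have hcard : (Fintype.card (Fin N → F × F) : ℝ) = (Fintype.card F : ℝ) ^ (N * 2) := by
    simp only [Fintype.card_pi, Fintype.card_prod, Finset.prod_const, Finset.card_univ,
      Fintype.card_fin]
    push_cast
    rw [mul_comm N 2, pow_mul, sq]
  rw [hcard]
  refine le_trans ?_ h'
  gcongr
  exact Finset.card_le_card_of_injOn coords (fun z hz => by simpa using hz)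
    coords_injective.injOn

/-! ### The encoded polynomials and recovery of their product -/

lemma encA_apply_mem {q K T ρ s : ℕ} (A : Matrix (Fin (K * ρ)) (Fin s) (ZMod q))
    (R : Fin T → Matrix (Fin ρ) (Fin s) (ZMod q)) (a : Fin ρ) (b : Fin s) :
    encA A R a b ∈ MvPolynomial.restrictSupport (ZMod q)
      {e : Fin 2 →₀ ℕ | e 0 < K + T ∧ e 1 = 0} := by
  simp only [encA, constMat, Matrix.add_apply, Matrix.sum_apply, Matrix.smul_apply,
    Matrix.map_apply, smul_eq_mul, MvPolynomial.X_pow_eq_monomial, mul_comm _ (MvPolynomial.C _),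
    MvPolynomial.C_mul_monomial, mul_one]
  refine add_mem (sum_mem fun i _ => ?_) (sum_mem fun t _ => ?_)
  · exact (MvPolynomial.monomial_mem_restrictSupport _).2 (Or.inl (by simp; omega))
  · exact (MvPolynomial.monomial_mem_restrictSupport _).2 (Or.inl (by simp))

lemma encB_apply_mem {q K L m T s γ : ℕ} (B : Matrix (Fin s) (Fin (L * γ)) (ZMod q))
    (S : Fin T → Fin m → Matrix (Fin s) (Fin γ) (ZMod q)) (a : Fin s) (b : Fin γ) :
    encB K B S a b ∈ MvPolynomial.restrictSupport (ZMod q)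
      {e : Fin 2 →₀ ℕ | (e 0 = 0 ∧ e 1 < L) ∨ (e 0 < K + T ∧ e 1 < m)} := by
  simp only [encB, constMat, Matrix.add_apply, Matrix.sum_apply, Matrix.smul_apply,
    Matrix.map_apply, smul_eq_mul, MvPolynomial.X_pow_eq_monomial, MvPolynomial.monomial_mul,
    mul_comm _ (MvPolynomial.C _), MvPolynomial.C_mul_monomial, mul_one]
  refine add_mem (sum_mem fun i _ => ?_) (sum_mem fun t _ => sum_mem fun j _ => ?_)
  · exact (MvPolynomial.monomial_mem_restrictSupport _).2 (Or.inl (by simp))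
  · exact (MvPolynomial.monomial_mem_restrictSupport _).2 (Or.inl (by simp))

lemma encA_mul_encB_apply_mem {q K L m T ρ s γ : ℕ}
    (A : Matrix (Fin (K * ρ)) (Fin s) (ZMod q)) (B : Matrix (Fin s) (Fin (L * γ)) (ZMod q))
    (R : Fin T → Matrix (Fin ρ) (Fin s) (ZMod q))
    (S : Fin T → Fin m → Matrix (Fin s) (Fin γ) (ZMod q)) (a : Fin ρ) (b : Fin γ) :
    (encA A R * encB K B S) a b ∈ MvPolynomial.restrictSupport (ZMod q) (monomials K L m T) := by
  classical
  rw [Matrix.mul_apply]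
  refine sum_mem fun u _ => ?_
  intro e he
  obtain ⟨e₁, h₁, e₂, h₂, rfl⟩ := Finset.mem_add.1 (MvPolynomial.support_mul _ _ he)
  have h₁' := encA_apply_mem A R a u h₁
  have h₂' := encB_apply_mem B S u b h₂
  simp only [monomials, Set.mem_ofPred_eq, Finsupp.add_apply] at h₁' h₂' ⊢
  omega

lemma iterate_pderiv_mul_of_pderiv_eq_zero {F σ : Type*} [CommSemiring F] {i : σ}
    {f : MvPolynomial σ F} (hf : MvPolynomial.pderiv i f = 0) (g : MvPolynomial σ F) (j : ℕ) :
    (⇑(MvPolynomial.pderiv (R := F) i))^[j] (f * g) =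
      f * (⇑(MvPolynomial.pderiv (R := F) i))^[j] g := by
  induction j with
  | zero => rfl
  | succ j ih =>
    rw [Function.iterate_succ_apply', ih, MvPolynomial.pderiv_mul, hf, zero_mul, zero_add,
      Function.iterate_succ_apply']

lemma pderiv_encA {q K T ρ s : ℕ} (A : Matrix (Fin (K * ρ)) (Fin s) (ZMod q))
    (R : Fin T → Matrix (Fin ρ) (Fin s) (ZMod q)) (a : Fin ρ) (b : Fin s) :
    MvPolynomial.pderiv 1 (encA A R a b) = 0 := by
  refine MvPolynomial.pderiv_eq_zero_of_notMem_vars fun h => ?_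
  obtain ⟨e, he, h1⟩ := (MvPolynomial.mem_vars_iff_mem_support _).1 h
  exact Finsupp.mem_support_iff.1 h1 (encA_apply_mem A R a b he).2

lemma evalAt_dY_mul {q K L m T ρ s γ : ℕ} (A : Matrix (Fin (K * ρ)) (Fin s) (ZMod q))
    (B : Matrix (Fin s) (Fin (L * γ)) (ZMod q)) (R : Fin T → Matrix (Fin ρ) (Fin s) (ZMod q))
    (S : Fin T → Fin m → Matrix (Fin s) (Fin γ) (ZMod q)) (z : ZMod q × ZMod q) (j : ℕ) :
    evalAt z (dY j (encA A R * encB K B S)) = response A B R S z j := by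
  ext a b
  simp only [evalAt, dY, response, Matrix.map_apply, Matrix.mul_apply, iterate_pderiv_sum,
    map_sum, iterate_pderiv_mul_of_pderiv_eq_zero (pderiv_encA A R _ _), map_mul]

/-- If the interpolation matrix of some of the results received is regular, then the master can
interpolate. -/
lemma canInterpolate_of_det_ne_zero {q : ℕ} [Fact q.Prime] {K L m T N ρ s γ : ℕ}
    (hm : 0 < m) (hmL : m ≤ L) {c c' : Fin N → ℕ} (hc : ∀ i, c' i ≤ c i)
    (σ : Fin (recoveryThreshold K L m T) ≃ (i : Fin N) × Fin (c' i))
    {z : Fin N → ZMod q × ZMod q} (hz : (interpMatrix (K + T) L m σ z).det ≠ 0) :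
    CanInterpolate K L m T ρ s γ c z := by
  intro A B R S P
  refine ⟨fun ⟨hsupp, hval⟩ => ?_, ?_⟩
  · ext1 a b
    rw [← sub_eq_zero]
    set f := P a b - (encA A R * encB K B S) a b with hf
    have hmem : f ∈ MvPolynomial.restrictSupport (ZMod q) (monomials K L m T) :=
      sub_mem (fun e he => hsupp a b e he) (encA_mul_encB_apply_mem A B R S a b)
    have hmem' : ∀ e ∈ f.support, e ∈ monomials K L m T := fun e he => hmem he
    have hder (i : Fin N) (j : ℕ) (hj : j < c' i) :
        MvPolynomial.eval ![(z i).1, (z i).2]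
          ((⇑(MvPolynomial.pderiv (R := ZMod q) 1))^[j] f) = 0 := by
      have h := (hval i j (hj.trans_le (hc i))).trans (evalAt_dY_mul A B R S (z i) j).symm
      have h' := congrFun (congrFun h a) b
      simp only [evalAt, dY, Matrix.map_apply] at h'
      rw [hf, iterate_map_sub, map_sub, h', sub_self]
    have hcoef : (fun e : Fin (recoveryThreshold K L m T) =>
        f.coeff (monomialExp (K + T) L m e)) = 0 := by
      refine Matrix.eq_zero_of_mulVec_eq_zero hz (funext fun r => ?_)
      have h := hder (σ r).1 (σ r).2 (σ r).2.2
      rw [eval_iterate_pderiv hm hmL hmem', Finset.sum_range] at h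
      simpa [interpMatrix, Matrix.mulVec, dotProduct] using h
    rw [sum_monomialExp hm hmL hmem']
    refine Finset.sum_eq_zero fun e he => ?_
    rw [show f.coeff (monomialExp (K + T) L m e) = 0 from
      congrFun hcoef ⟨e, Finset.mem_range.1 he⟩, MvPolynomial.monomial_zero]
  · rintro rfl
    exact ⟨fun a b e he => encA_mul_encB_apply_mem A B R S a b he,
      fun i j _ => evalAt_dY_mul A B R S (z i) j⟩

/-- `y ^ (L - 1)` is one of the monomials. -/
lemma pred_le_degreeSum {K L m T : ℕ} (hK : 0 < K) (hL : 0 < L) (hm : 0 < m) :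
    ((L - 1 : ℕ) : ℝ) ≤ degreeSum K L m T := by
  rw [← sum_exponents hK hL hm, Nat.cast_le]
  have hlt : L - 1 < (K + T) * L := by nlinarith [Nat.sub_lt hL one_pos]
  refine le_trans ?_ (Finset.single_le_sum (fun _ _ => Nat.zero_le _) (Finset.mem_range.2
    (hlt.trans_le (Nat.le_add_right _ _) : L - 1 < recoveryThreshold K L m T)))
  rw [expY_of_lt hlt, Nat.mod_eq_of_lt (Nat.sub_lt hL one_pos)]
  exact Nat.le_add_left _ _

end BivariateCode

/-! ### The probability bound -/

open BivariateCode in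
theorem theorem2 (q : ℕ) [Fact q.Prime] (K L m T N ρ s γ : ℕ)
    (hK : 0 < K) (hL : 0 < L) (hm : 0 < m) (hmL : m ≤ L)
    (c : Fin N → ℕ) (hc : ∀ i, c i ≤ m)
    (hR : BivariateCode.recoveryThreshold K L m T ≤ ∑ i, c i) :
    1 - BivariateCode.degreeSum K L m T / (q : ℝ) ≤
      ((PMF.uniformOfFintype (Fin N → ZMod q × ZMod q)).toOuterMeasure
        {z | BivariateCode.CanInterpolate K L m T ρ s γ c z}).toReal := by
  classical
  have hq : (0 : ℝ) < q := by exact_mod_cast (Fact.out : q.Prime).pos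
  rcases le_or_gt (q : ℝ) (degreeSum K L m T) with hd | hd
  · exact (sub_nonpos.2 ((one_le_div hq).2 hd)).trans ENNReal.toReal_nonneg
  have hLq : L ≤ q := by
    have : ((L - 1 : ℕ) : ℝ) < q := (pred_le_degreeSum hK hL hm).trans_lt hd
    have : L - 1 < q := by exact_mod_cast this
    omega
  obtain ⟨c', hc', hsum⟩ := exists_le_sum_eq c hR
  have σ : Fin (recoveryThreshold K L m T) ≃ (i : Fin N) × Fin (c' i) :=
    Fintype.equivOfCardEq (by simp [hsum])
  let p : MvPolynomial (Fin (N * 2)) (ZMod q) := (interpMatrix (K + T) L m σ fun i =>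
    (MvPolynomial.X (finProdFinEquiv (i, 0)), MvPolynomial.X (finProdFinEquiv (i, 1)))).det
  have hp : p ≠ 0 := by
    -- `ZMod q` may have too few parameters `t`; a non-root over the infinite closure still shows `p
    -- ≠ 0`.
    have hchar : CharP (AlgebraicClosure (ZMod q)) q :=
      charP_of_injective_algebraMap (algebraMap (ZMod q) (AlgebraicClosure (ZMod q))).injective q
    obtain ⟨z, hz⟩ := exists_det_interpMatrix_ne_zero (k := AlgebraicClosure (ZMod q))
      (n := K + T) hm hmL
      (fun a ha b hb h => CharP.natCast_injOn_Iio (AlgebraicClosure (ZMod q)) q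
        (ha.trans_le hLq) (hb.trans_le hLq) h)
      (fun i => (hc' i).trans (hc i)) σ
    intro h0
    refine hz ?_
    have h := map_det_interpMatrix (MvPolynomial.aeval (R := ZMod q)
      (coords z)).toRingHom (K + T) L m σ fun i =>
      (MvPolynomial.X (finProdFinEquiv (i, 0)), MvPolynomial.X (finProdFinEquiv (i, 1)))
    rw [show (interpMatrix (K + T) L m σ fun i => ((MvPolynomial.X (finProdFinEquiv (i, 0)) :
      MvPolynomial (Fin (N * 2)) (ZMod q)), MvPolynomial.X (finProdFinEquiv (i, 1)))).det = 0
      from h0, map_zero] at h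
    simpa using h.symm
  have hgood (z : Fin N → ZMod q × ZMod q) (hz : MvPolynomial.eval (coords z) p ≠ 0) :
      CanInterpolate K L m T ρ s γ c z := by
    refine canInterpolate_of_det_ne_zero hm hmL hc' σ ?_
    rw [map_det_interpMatrix] at hz
    simpa using hz
  have hdeg : (p.totalDegree : ℝ) ≤ degreeSum K L m T := by
    rw [← sum_exponents hK hL hm]
    exact_mod_cast totalDegree_det_interpMatrix_le (K + T) L m σ _ _
  have hzeros := card_zeros_le hp
  rw [ZMod.card] at hzeros
  have hbad := hzeros.trans (div_le_div_of_nonneg_right hdeg hq.le)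
  rw [PMF.toOuterMeasure_uniformOfFintype_apply, ENNReal.toReal_div, ENNReal.toReal_natCast,
    ENNReal.toReal_natCast]
  have hcard : (0 : ℝ) < Fintype.card (Fin N → ZMod q × ZMod q) := by
    exact_mod_cast Fintype.card_pos
  have hsplit := Finset.card_filter_add_card_filter_not (s := Finset.univ)
    (fun z : Fin N → ZMod q × ZMod q => MvPolynomial.eval (coords z) p = 0)
  have hle : (Finset.univ.filter fun z : Fin N → ZMod q × ZMod q =>
      ¬ MvPolynomial.eval (coords z) p = 0).card ≤
      Fintype.card {z : Fin N → ZMod q × ZMod q | CanInterpolate K L m T ρ s γ c z} := by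
    rw [Fintype.card_ofFinset]
    exact Finset.card_le_card fun z hz => by simpa using hgood z (Finset.mem_filter.1 hz).2
  rw [Finset.card_univ] at hsplit
  rw [le_div_iff₀ hcard]
  rw [div_le_iff₀ hcard] at hbad
  have h1 := congrArg (Nat.cast (R := ℝ)) hsplit
  have h2 := Nat.cast_le (α := ℝ).2 hle
  rw [Nat.cast_add] at h1
  rw [sub_mul, one_mul]
  linarith
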